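/- Let $(\mathcal X,d)$ be a proper (closed balls are compact) Polish metric space, let $\mathcal Y=\{1,\dots,K\}$ with the discrete metric, and write $\mathcal M_+^1(\mathcal Z)$ for the set of Borel probability measures on $\mathcal Z$. Let $\mathbb P\in\mathcal M_+^1(\mathcal X\times\mathcal Y)$ and $\varepsilon>0$. Write $\Pi_1,\Pi_2:(\mathcal X\times\mathcal Y)^2\to\mathcal X\times\mathcal Y$ for the two projections, and for $\mathbb Q\in\mathcal M_+^1(\mathcal X\times\mathcal Y)$ let $$\Gamma_{\mathbb P,\mathbb Q}:=\{\gamma\in\mathcal M_+^1((\mathcal X\times\mathcal Y)^2)\mid \Pi_{1\sharp}\gamma=\mathbb P,\ \Pi_{2\sharp}\gamma=\mathbb Q\}.$$ Define the set of adversarial distributions $$\mathcal A_\varepsilon(\mathbb P):=\{\mathbb Q\in\mathcal M_+^1(\mathcal X\times\mathcal Y)\mid \exists\gamma\in\Gamma_{\mathbb P,\mathbb Q}:\ d(x,x')\le\varepsilon \text{ and } y=y' \text{ for } \gamma\text{-almost every } ((x,y),(x',y'))\},$$ the cost $c_\varepsilon((x,y),(x',y')):=0$ if $d(x,x')\le\varepsilon$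 and $y=y'$, and $:=+\infty$ otherwise, the optimal transport value $W_{c_\varepsilon}(\mathbb P,\mathbb Q):=\inf_{\gamma\in\Gamma_{\mathbb P,\mathbb Q}}\int c_\varepsilon\,d\gamma$, and, for $0\le\eta<\infty$, the Wasserstein ball $$\mathcal B_{c_\varepsilon}(\mathbb P,\eta):=\{\mathbb Q\in\mathcal M_+^1(\mathcal X\times\mathcal Y)\mid W_{c_\varepsilon}(\mathbb P,\mathbb Q)\le\eta\}.$$ Then $\mathcal B_{c_\varepsilon}(\mathbb P,\eta)=\mathcal A_\varepsilon(\mathbb P)$ for every real $\eta\ge 0$. Moreover, $\mathcal A_\varepsilon(\mathbb P)$ is convex, and it is compact for the weak topology of $\mathcal M_+^1(\mathcal X\times\mathcal Y)$ (the topology of convergence of integrals of bounded continuous functions). -/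

import Mathlib

open MeasureTheory
open scoped NNReal ENNReal

namespace AdversarialGame

section OptimalTransport

variable {Z : Type*} [MeasurableSpace Z]

/-- The set `Γ_{P,Q}` of couplings of `P` and `Q`: probability measures on `Z × Z` whose first
marginal is `P` and whose second marginal is `Q`. -/
def couplings (P Q : ProbabilityMeasure Z) : Set (ProbabilityMeasure (Z × Z)) :=
  {γ | (γ : Measure (Z × Z)).map Prod.fst = (P : Measure Z) ∧
    (γ : Measure (Z × Z)).map Prod.snd = (Q : Measure Z)}

/-- The optimal transport value `W_c(P, Q) = inf_{γ ∈ Γ_{P,Q}} ∫ c(z, z') dγ(z, z')` for a cost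
with values in `[0, ∞]`. -/
noncomputable def transportCost (c : Z → Z → ℝ≥0∞) (P Q : ProbabilityMeasure Z) : ℝ≥0∞ :=
  ⨅ γ ∈ couplings P Q, ∫⁻ z, c z.1 z.2 ∂(γ : Measure (Z × Z))

/-- The Wasserstein uncertainty set `B_c(P, η) = {Q | W_c(P, Q) ≤ η}`, for a finite radius `η`. -/
def wassersteinBall (c : Z → Z → ℝ≥0∞) (P : ProbabilityMeasure Z) (η : ℝ≥0) :
    Set (ProbabilityMeasure Z) :=
  {Q | transportCost c P Q ≤ (η : ℝ≥0∞)}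

end OptimalTransport

section Adversarial

variable {X Y : Type*} [MetricSpace X]

open Classical in
/-- The cost `c_ε`: it is `0` if `d(x, x') ≤ ε` and `y = y'`, and `+∞` otherwise. -/
noncomputable def advCost (ε : ℝ) (z z' : X × Y) : ℝ≥0∞ :=
  if dist z.1 z'.1 ≤ ε ∧ z.2 = z'.2 then 0 else ∞

/-- The set `A_ε(P)` of adversarial distributions: the laws `Q` for which some probability measure
`γ` on `(X × Y)²` has marginals `P` and `Q` and satisfies `d(x, x') ≤ ε` and `y = y'` almost
surely. -/
def advSet [MeasurableSpace X] [MeasurableSpace Y] (ε : ℝ) (P : ProbabilityMeasure (X × Y)) :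
    Set (ProbabilityMeasure (X × Y)) :=
  {Q | ∃ γ : ProbabilityMeasure ((X × Y) × (X × Y)),
    (∀ᵐ z ∂(γ : Measure ((X × Y) × (X × Y))), dist z.1.1 z.2.1 ≤ ε ∧ z.1.2 = z.2.2) ∧
    (γ : Measure ((X × Y) × (X × Y))).map Prod.fst = (P : Measure (X × Y)) ∧
    (γ : Measure ((X × Y) × (X × Y))).map Prod.snd = (Q : Measure (X × Y))}

end Adversarial

end AdversarialGame

/-! The cost takes only the values `0` and `∞`, so a coupling of finite cost is concentrated on
`advRel`, where the cost vanishes; hence the radius `η` plays no role. Convexity follows by mixing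
couplings, since marginals and null sets respect mixtures. For compactness, `advSet` is the
continuous image, under the second marginal, of `advCouplings`, which is closed and tight, hence
compact by Prokhorov's theorem. -/

namespace AdversarialGame

section Support

variable {X Y : Type*} [MetricSpace X]

/-- The set of pairs of labelled points at distance at most `ε` and with equal labels. -/
def advRel (X Y : Type*) [MetricSpace X] (ε : ℝ) : Set ((X × Y) × (X × Y)) :=
  {z | dist z.1.1 z.2.1 ≤ ε ∧ z.1.2 = z.2.2}

lemma isClosed_advRel [TopologicalSpace Y] [T2Space Y] (ε : ℝ) : IsClosed (advRel X Y ε) := by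
  have h₁ : IsClosed {z : (X × Y) × (X × Y) | dist z.1.1 z.2.1 ≤ ε} :=
    isClosed_le (by fun_prop) (by fun_prop)
  have h₂ : IsClosed {z : (X × Y) × (X × Y) | z.1.2 = z.2.2} :=
    isClosed_eq (by fun_prop) (by fun_prop)
  exact h₁.inter h₂

lemma advCost_eq_zero {ε : ℝ} {z : (X × Y) × (X × Y)} (h : z ∈ advRel X Y ε) :
    advCost ε z.1 z.2 = 0 := if_pos h

lemma mem_advRel_of_advCost_ne_top {ε : ℝ} {z : (X × Y) × (X × Y)}
    (h : advCost ε z.1 z.2 ≠ ∞) : z ∈ advRel X Y ε := by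
  by_contra h'
  exact h (if_neg h')

end Support

section Ball

variable {X Y : Type*} [MetricSpace X] [MeasurableSpace X] [MeasurableSpace Y]

lemma advSet_subset_wassersteinBall (ε : ℝ) (P : ProbabilityMeasure (X × Y)) (η : ℝ≥0) :
    advSet ε P ⊆ wassersteinBall (advCost ε) P η := by
  rintro Q ⟨γ, hγ, h₁, h₂⟩
  have hγ' : γ ∈ couplings P Q := ⟨h₁, h₂⟩
  refine (iInf₂_le γ hγ').trans (le_of_eq_of_le ?_ (zero_le : 0 ≤ (η : ℝ≥0∞)))
  rw [lintegral_congr_ae (g := fun _ ↦ 0) (hγ.mono fun z hz ↦ advCost_eq_zero hz), lintegral_zero]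

/-- The infimum need not be known to be attained: once it is finite, some coupling has finite cost,
and that one is a witness. -/
lemma wassersteinBall_subset_advSet {ε : ℝ} {P : ProbabilityMeasure (X × Y)} {η : ℝ≥0}
    (hmeas : MeasurableSet (advRel X Y ε)) :
    wassersteinBall (advCost ε) P η ⊆ advSet ε P := by
  intro Q hQ
  have hlt : transportCost (advCost ε) P Q < ∞ := lt_of_le_of_lt hQ ENNReal.coe_lt_top
  obtain ⟨γ, hγ, hfin⟩ : ∃ γ ∈ couplings P Q,
      ∫⁻ z, advCost ε z.1 z.2 ∂(γ : Measure ((X × Y) × (X × Y))) < ∞ := by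
    simpa only [transportCost, iInf_lt_iff, exists_prop] using hlt
  have hcost : Measurable fun z : (X × Y) × (X × Y) ↦ advCost ε z.1 z.2 := by
    classical
    exact Measurable.ite hmeas measurable_const measurable_const
  exact ⟨γ, (ae_lt_top hcost hfin.ne).mono fun z hz ↦ mem_advRel_of_advCost_ne_top hz.ne,
    hγ.1, hγ.2⟩

lemma convex_advSet (ε : ℝ) (P : ProbabilityMeasure (X × Y)) :
    Convex ℝ≥0 ((fun Q : ProbabilityMeasure (X × Y) ↦ (Q : Measure (X × Y))) '' advSet ε P) := by
  rintro _ ⟨Q₁, ⟨γ₁, h₁, hP₁, hQ₁⟩, rfl⟩ _ ⟨Q₂, ⟨γ₂, h₂, hP₂, hQ₂⟩, rfl⟩ a b - - hab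
  have hab' : (a : ℝ≥0∞) + b = 1 := by exact_mod_cast hab
  have hprob {Z : Type _} [MeasurableSpace Z] (μ ν : ProbabilityMeasure Z) :
      IsProbabilityMeasure (a • (μ : Measure Z) + b • (ν : Measure Z)) :=
    ⟨by
      rw [Measure.add_apply, Measure.smul_apply, Measure.smul_apply, measure_univ, measure_univ,
        ENNReal.smul_def, ENNReal.smul_def, smul_eq_mul, smul_eq_mul, mul_one, mul_one, hab']⟩
  refine ⟨⟨_, hprob Q₁ Q₂⟩, ⟨⟨_, hprob γ₁ γ₂⟩, ?_, ?_, ?_⟩, rfl⟩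
  · exact ae_add_measure_iff.2 ⟨Measure.ae_smul_measure h₁ a, Measure.ae_smul_measure h₂ b⟩
  · simp only [ProbabilityMeasure.coe_mk, Measure.map_add _ _ measurable_fst, Measure.map_smul,
      hP₁, hP₂, ← add_smul, hab, one_smul]
  · simp only [ProbabilityMeasure.coe_mk, Measure.map_add _ _ measurable_snd, Measure.map_smul,
      hQ₁, hQ₂]

end Ball

/-- Portmanteau: the mass of the open set `Cᶜ` is lower semicontinuous, so its vanishing passes to
weak limits. -/
lemma isClosed_setOf_ae_mem {Z : Type*} [TopologicalSpace Z] [MeasurableSpace Z]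
    [OpensMeasurableSpace Z] [HasOuterApproxClosed Z] {C : Set Z} (hC : IsClosed C) :
    IsClosed {γ : ProbabilityMeasure Z | ∀ᵐ z ∂(γ : Measure Z), z ∈ C} := by
  refine isClosed_iff_forall_filter.2 fun γ L _ hL hγ ↦ ?_
  have h := ProbabilityMeasure.le_liminf_measure_open_of_tendsto
    (μs := fun μ : ProbabilityMeasure Z ↦ μ) (L := L) hγ hC.isOpen_compl
  have hzero : (fun μ : ProbabilityMeasure Z ↦ (μ : Measure Z) Cᶜ) =ᶠ[L] fun _ ↦ 0 :=
    hL fun μ hμ ↦ hμ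
  rw [Filter.liminf_congr hzero, Filter.liminf_const] at h
  exact le_antisymm h zero_le

section Compact

variable {X Y : Type*} [MetricSpace X] [ProperSpace X] [MeasurableSpace X] [BorelSpace X]
  [TopologicalSpace Y] [PolishSpace Y] [CompactSpace Y] [MeasurableSpace Y] [BorelSpace Y]

/-- The laws of the pairs whose first component is distributed as `P` and which are almost surely
`ε`-close with equal labels. -/
def advCouplings (ε : ℝ) (P : ProbabilityMeasure (X × Y)) :
    Set (ProbabilityMeasure ((X × Y) × (X × Y))) :=
  {γ | (∀ᵐ z ∂(γ : Measure ((X × Y) × (X × Y))), z ∈ advRel X Y ε) ∧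
    (γ : Measure ((X × Y) × (X × Y))).map Prod.fst = (P : Measure (X × Y))}

lemma isTightMeasureSet_advCouplings (ε : ℝ) (P : ProbabilityMeasure (X × Y)) :
    IsTightMeasureSet {((γ : ProbabilityMeasure ((X × Y) × (X × Y))) :
      Measure ((X × Y) × (X × Y))) | γ ∈ advCouplings ε P} := by
  rw [isTightMeasureSet_iff_exists_isCompact_measure_compl_le]
  intro δ hδ
  obtain ⟨K, hK, hPK⟩ := isTightMeasureSet_iff_exists_isCompact_measure_compl_le.1
    (isTightMeasureSet_singleton (μ := (P : Measure (X × Y)))) δ hδ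
  -- A pair in `advRel` starting in `K` ends within `ε` of the projection of `K`; properness of `X`
  -- makes this thickening compact.
  refine ⟨K ×ˢ (Metric.cthickening ε (Prod.fst '' K) ×ˢ Set.univ),
    hK.prod ((hK.image continuous_fst).cthickening.prod isCompact_univ), ?_⟩
  rintro _ ⟨γ, ⟨hγ, hP⟩, rfl⟩
  calc (γ : Measure ((X × Y) × (X × Y)))
        (K ×ˢ (Metric.cthickening ε (Prod.fst '' K) ×ˢ Set.univ))ᶜ
      ≤ (γ : Measure ((X × Y) × (X × Y))) (Prod.fst ⁻¹' Kᶜ) := by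
        refine measure_mono_ae (hγ.mono fun z hz (hzC : z ∉ _) (hzK : z.1 ∈ K) ↦ ?_)
        exact hzC ⟨hzK, Metric.mem_cthickening_of_dist_le _ _ _ _ (Set.mem_image_of_mem _ hzK)
          (by simpa [dist_comm] using hz.1), Set.mem_univ _⟩
    _ = (P : Measure (X × Y)) Kᶜ := by
        rw [← hP, Measure.map_apply measurable_fst hK.isClosed.measurableSet.compl]
    _ ≤ δ := hPK _ rfl

lemma isClosed_advCouplings (ε : ℝ) (P : ProbabilityMeasure (X × Y)) :
    IsClosed (advCouplings ε P) := by
  refine (isClosed_setOf_ae_mem (isClosed_advRel ε)).inter ?_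
  have h := isClosed_singleton (x := P) |>.preimage
    (ProbabilityMeasure.continuous_map (continuous_fst (X := X × Y) (Y := X × Y)))
  refine (congrArg IsClosed (Set.ext fun γ ↦ ?_)).mp h
  rw [Set.mem_preimage, Set.mem_singleton_iff, ← ProbabilityMeasure.toMeasure_injective.eq_iff,
    ProbabilityMeasure.toMeasure_map]
  rfl

lemma isCompact_advCouplings (ε : ℝ) (P : ProbabilityMeasure (X × Y)) :
    IsCompact (advCouplings ε P) := by
  rw [← (isClosed_advCouplings ε P).closure_eq]
  exact isCompact_closure_of_isTightMeasureSet (isTightMeasureSet_advCouplings ε P)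

lemma isCompact_advSet (ε : ℝ) (P : ProbabilityMeasure (X × Y)) : IsCompact (advSet ε P) := by
  -- The second marginal, left free in `advCouplings`, sweeps out exactly the adversarial laws.
  convert (isCompact_advCouplings ε P).image
    (ProbabilityMeasure.continuous_map (continuous_snd (X := X × Y) (Y := X × Y))) using 1
  ext Q
  refine exists_congr fun γ ↦ ?_
  rw [← and_assoc]
  refine and_congr Iff.rfl ?_
  rw [← ProbabilityMeasure.toMeasure_injective.eq_iff, ProbabilityMeasure.toMeasure_map]

end Compact

end AdversarialGame

/-- `X` is a proper metric space (hence complete and separable) with its Borel `σ`-algebra, and the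
label set `{1, …, K}` is `Fin K` with its discrete topology and `σ`-algebra. The topology on
`ProbabilityMeasure (X × Fin K)` is that of weak convergence. Convexity is that of the set of
underlying measures: `a • Q₁ + b • Q₂` stays in the set for all `a, b ≥ 0` with `a + b = 1`. -/
theorem mainTheorem3 {X : Type*} [MetricSpace X] [ProperSpace X] [MeasurableSpace X] [BorelSpace X]
    (K : ℕ) (P : ProbabilityMeasure (X × Fin K)) (ε : ℝ) (hε : 0 < ε) :
    (∀ η : ℝ≥0, AdversarialGame.wassersteinBall (AdversarialGame.advCost ε) P η
      = AdversarialGame.advSet ε P) ∧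
    Convex ℝ≥0 ((fun Q : ProbabilityMeasure (X × Fin K) => (Q : Measure (X × Fin K))) ''
      AdversarialGame.advSet ε P) ∧
    IsCompact (AdversarialGame.advSet ε P) := by
  refine ⟨fun η ↦ ?_, AdversarialGame.convex_advSet ε P, AdversarialGame.isCompact_advSet ε P⟩
  exact (AdversarialGame.wassersteinBall_subset_advSet
    (AdversarialGame.isClosed_advRel ε).measurableSet).antisymm
    (AdversarialGame.advSet_subset_wassersteinBall ε P η)
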